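/- Let $d$ be a natural number, let $\mathbb F_d^*$ be the unital free semigroup (the words, with length $|w|$) on $d$ generators, let $\ell^2(\mathbb F_d^*)$ be the Hilbert space with orthonormal basis $\{\xi_w\}_{w\in\mathbb F_d^*}$, and let $L_u$ be the isometry with $L_u\xi_w=\xi_{uw}$. Let $\mathcal L_d$ be the unital WOT-closed algebra generated by $\{L_u : u\in\mathbb F_d^*\}$, with the comultiplication $\Delta:\mathcal L_d\to\mathcal L_d\,\overline\otimes\,\mathcal L_d$, i.e. the weak*-continuous unital homomorphism with $\Delta(L_w)=L_w\otimes L_w$ for all $w$. A set $\mathcal J\subset\mathcal L_d$ is a coideal if it is a weak*-closed subspace with $\Delta(\mathcal J)\subset\overline{\mathcal J\otimes\mathcal L_d+\mathcal L_d\otimes\mathcal J}^{w^*}$, and it is homogeneous if it is the weak*-closed span of its homogeneous elements, where the homogeneous elements of degree $n\ge 0$ are the linear combinations of the $L_w$ with $|w|=n$. Then $\mathcal J$ is a homogeneous coideal of $\mathcal L_d$ if and only if there are pairwise disjoint (possibly empty) subsets $W,W_1,W_2,\ldots$ of $\mathbb F_d^*$ such that for each $i\geq 1$ all words in $W_i$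 have the same length, and \[ \mathcal J=\overline{\operatorname{span}}^{\,w^*}\big(\{L_u-L_v : u,v\in W_i,\ i\ge 1\}\cup\{L_w : w\in W\}\big). \] -/

import Mathlib

noncomputable section

namespace NCToeplitz

/-! ### Hilbert spaces with a distinguished orthonormal basis, and their operators -/

/-- The Hilbert space `ℓ²(X)`. -/
abbrev Ell2 (X : Type) : Type := lp (fun _ : X => ℂ) 2

/-- The bounded operators on `ℓ²(X)`. -/
abbrev Op (X : Type) : Type := Ell2 X →L[ℂ] Ell2 X

/-- The standard basis vector `ξ_x` of `ℓ²(X)`. -/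
def ket {X : Type} (x : X) : Ell2 X := by
  classical exact lp.single 2 x (1 : ℂ)

theorem inner_ket {X : Type} (x : X) (f : Ell2 X) : inner ℂ (ket x) f = f x := by
  classical
  rw [ket, lp.inner_single_left]
  simp

theorem orthonormal_ket (X : Type) : Orthonormal ℂ (ket : X → Ell2 X) := by
  classical
  rw [orthonormal_iff_ite]
  intro x y
  rw [inner_ket, ket, lp.single_apply]
  by_cases h : x = y
  · subst h; simp
  · simp [h]

theorem ket_ext {X : Type} {E : Type*} [NormedAddCommGroup E] [NormedSpace ℂ E]
    {A B : Ell2 X →L[ℂ] E} (h : ∀ x, A (ket x) = B (ket x)) : A = B := by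
  classical
  refine lp.ext_continuousLinearMap (by simp) fun x => ?_
  ext
  simpa [ket] using h x

/-- The isometry `ℓ²(X) → ℓ²(Y)` with `ξ_x ↦ ξ_{f x}`, for an injective map `f : X → Y`. -/
def relabel {X Y : Type} (f : X → Y) (hf : Function.Injective f) : Ell2 X →ₗᵢ[ℂ] Ell2 Y :=
  ((orthonormal_ket Y).comp f hf).orthogonalFamily.linearIsometry

theorem relabel_ket {X Y : Type} (f : X → Y) (hf : Function.Injective f) (x : X) :
    relabel f hf (ket x) = ket (f x) := by
  classical
  simp [relabel, ket]

/-- The weak* topology on the bounded operators of a Hilbert space, as the dual of the trace class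
operators: the coarsest topology which makes `A ↦ ∑ ⟨x_n, A y_n⟩` continuous for all sequences
`x`, `y` of vectors with `∑ ‖x_n‖² < ∞` and `∑ ‖y_n‖² < ∞` (every trace class functional has
this form). -/
@[reducible] def weakStar (H : Type*) [NormedAddCommGroup H] [InnerProductSpace ℂ H] :
    TopologicalSpace (H →L[ℂ] H) :=
  ⨅ (x : ℕ → H) (y : ℕ → H) (_ : Summable fun n => ‖x n‖ ^ 2) (_ : Summable fun n => ‖y n‖ ^ 2),
    TopologicalSpace.induced (fun A : H →L[ℂ] H => ∑' n, inner ℂ (x n) (A (y n)))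
      (inferInstance : TopologicalSpace ℂ)

/-- The weak*-closed linear span of a set of operators. -/
def weakStarSpan {H : Type*} [NormedAddCommGroup H] [InnerProductSpace ℂ H]
    (S : Set (H →L[ℂ] H)) : Set (H →L[ℂ] H) :=
  @closure (H →L[ℂ] H) (weakStar H) (Submodule.span ℂ S : Set (H →L[ℂ] H))

/-! ### Amplifications and tensor products of operators -/

theorem orthogonalFamily_relabel {I X Z : Type} (g : I → X → Z)
    (hg : Function.Injective fun p : I × X => g p.1 p.2) :
    OrthogonalFamily ℂ (fun _ : I => Ell2 X)
      fun i => relabel (g i) (fun _ _ h => (Prod.mk.inj (hg (a₁ := (i, _)) (a₂ := (i, _)) h)).2) := by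
  intro i j hij v w
  have hi : Function.Injective (g i) :=
    fun _ _ h => (Prod.mk.inj (hg (a₁ := (i, _)) (a₂ := (i, _)) h)).2
  have hj : Function.Injective (g j) :=
    fun _ _ h => (Prod.mk.inj (hg (a₁ := (j, _)) (a₂ := (j, _)) h)).2
  have h1 : ((relabel (g i) hi).toContinuousLinearMap.adjoint ∘L
      (relabel (g j) hj).toContinuousLinearMap) = 0 := by
    refine ket_ext fun y => ?_
    ext x
    rw [← inner_ket]
    simp only [ContinuousLinearMap.comp_apply, ContinuousLinearMap.adjoint_inner_right,
      LinearIsometry.coe_toContinuousLinearMap, relabel_ket]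
    refine (orthonormal_ket Z).2 fun h => hij ?_
    exact (Prod.mk.inj (hg (a₁ := (i, x)) (a₂ := (j, y)) h)).1
  have h2 := congrArg (fun T => inner ℂ v (T w)) h1
  simpa [ContinuousLinearMap.adjoint_inner_right] using h2

/-- For an injective map `g : I × X → Z` let `V_i : ℓ²(X) → ℓ²(Z)`, `ξ_x ↦ ξ_{g i x}`; these are
isometries with pairwise orthogonal ranges. `ampl g A` is the operator `∑_i V_i A V_i*`: it acts
as a copy of `A` on each of these ranges, and as zero on the orthogonal complement of all of
them (which is trivial when `g` is surjective). -/
def ampl {I X Z : Type} (g : I → X → Z)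
    (hg : Function.Injective fun p : I × X => g p.1 p.2) (A : Op X) : Op Z :=
  (orthogonalFamily_relabel g hg).linearIsometry.toContinuousLinearMap ∘L
    lp.mapCLM 2 (fun _ : I => A) (norm_nonneg A) (fun _ => le_rfl) ∘L
      (orthogonalFamily_relabel g hg).linearIsometry.toContinuousLinearMap.adjoint

theorem ampl_relabel {I X Z : Type} (g : I → X → Z)
    (hg : Function.Injective fun p : I × X => g p.1 p.2) (A : Op X) (i : I)
    (hi : Function.Injective (g i)) (f : Ell2 X) :
    ampl g hg A (relabel (g i) hi f) = relabel (g i) hi (A f) := by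
  classical
  have h := orthogonalFamily_relabel g hg
  have e1 (f : Ell2 X) : h.linearIsometry (lp.single 2 i f) = relabel (g i) hi f :=
    h.linearIsometry_apply_single f
  have e2 : h.linearIsometry.toContinuousLinearMap.adjoint (relabel (g i) hi f)
      = lp.single 2 i f := by
    rw [← e1]
    refine ext_inner_left ℂ fun v => ?_
    rw [ContinuousLinearMap.adjoint_inner_right]
    exact h.linearIsometry.inner_map_map v _
  have e3 : lp.mapCLM 2 (fun _ : I => A) (norm_nonneg A) (fun _ => le_rfl) (lp.single 2 i f)
      = lp.single 2 i (A f) := by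
    ext j : 2
    by_cases hj : j = i
    · subst hj; simp
    · simp [hj, lp.single_apply]
  simp only [ampl, ContinuousLinearMap.comp_apply, e2, e3]
  exact e1 _

theorem ampl_ket {I X Z : Type} (g : I → X → Z)
    (hg : Function.Injective fun p : I × X => g p.1 p.2) (A : Op X) (i : I)
    (hi : Function.Injective (g i)) (x : X) :
    ampl g hg A (ket (g i x)) = relabel (g i) hi (A (ket x)) := by
  rw [← relabel_ket (g i) hi, ampl_relabel]

theorem ampl_add {I X Z : Type} (g : I → X → Z)
    (hg : Function.Injective fun p : I × X => g p.1 p.2) (A B : Op X) :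
    ampl g hg (A + B) = ampl g hg A + ampl g hg B := by
  simp only [ampl, ← ContinuousLinearMap.comp_add, ← ContinuousLinearMap.add_comp]
  congr 2

theorem ampl_smul {I X Z : Type} (g : I → X → Z)
    (hg : Function.Injective fun p : I × X => g p.1 p.2) (c : ℂ) (A : Op X) :
    ampl g hg (c • A) = c • ampl g hg A := by
  rw [ampl, ampl, ← ContinuousLinearMap.comp_smul, ← ContinuousLinearMap.smul_comp]
  congr 2

theorem ampl_mul {I X Z : Type} (g : I → X → Z)
    (hg : Function.Injective fun p : I × X => g p.1 p.2) (A B : Op X) :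
    ampl g hg (A * B) = ampl g hg A * ampl g hg B := by
  have h (f : lp (fun _ : I => Ell2 X) 2) :
      (orthogonalFamily_relabel g hg).linearIsometry.toContinuousLinearMap.adjoint
        ((orthogonalFamily_relabel g hg).linearIsometry f) = f := by
    refine ext_inner_left ℂ fun v => ?_
    rw [ContinuousLinearMap.adjoint_inner_right]
    exact LinearIsometry.inner_map_map _ v f
  ext1 f
  simp only [ampl, mul_apply_eq_comp, ContinuousLinearMap.comp_apply,
    LinearIsometry.coe_toContinuousLinearMap, h]
  congr 1

theorem hasSum_norm_sq {I X : Type} (f : lp (fun _ : I => Ell2 X) 2) :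
    HasSum (fun i => ‖f i‖ ^ 2) (‖f‖ ^ 2) := by
  have h := lp.hasSum_norm (p := 2) (by norm_num) f
  simpa only [ENNReal.toReal_ofNat, Real.rpow_ofNat] using h

theorem continuous_ampl {I X Z : Type} [Countable I] (g : I → X → Z)
    (hg : Function.Injective fun p : I × X => g p.1 p.2) :
    @Continuous _ _ (weakStar (Ell2 X)) (weakStar (Ell2 Z)) (ampl g hg) := by
  simp only [continuous_iInf_rng, continuous_induced_rng]
  intro x y hx hy
  obtain ⟨e, he⟩ := exists_injective_nat (ℕ × I)
  set Φ := (orthogonalFamily_relabel g hg).linearIsometry.toContinuousLinearMap with hΦ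
  let a : (ℕ → Ell2 Z) → ℕ × I → Ell2 X := fun z p => Φ.adjoint (z p.1) p.2
  have ha (z : ℕ → Ell2 Z) (hz : Summable fun n => ‖z n‖ ^ 2) :
      Summable fun p => ‖a z p‖ ^ 2 := by
    rw [summable_prod_of_nonneg (fun p => sq_nonneg ‖a z p‖)]
    refine ⟨fun n => (hasSum_norm_sq (Φ.adjoint (z n))).summable, ?_⟩
    refine Summable.of_nonneg_of_le (fun n => tsum_nonneg fun i => sq_nonneg ‖a z (n, i)‖)
      (fun n => ?_) (hz.mul_left (‖Φ.adjoint‖ ^ 2))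
    change ∑' i, ‖Φ.adjoint (z n) i‖ ^ 2 ≤ _
    rw [(hasSum_norm_sq (Φ.adjoint (z n))).tsum_eq, ← mul_pow]
    gcongr
    exact Φ.adjoint.le_opNorm _
  have hext (z : ℕ × I → Ell2 X) (hz : Summable fun p => ‖z p‖ ^ 2) :
      Summable fun n => ‖Function.extend e z 0 n‖ ^ 2 := by
    rw [← he.summable_iff]
    · simpa [Function.comp_def, he.extend_apply] using hz
    · intro n hn
      rw [Function.extend_apply' _ _ _ (by simpa using hn)]
      simp
  have hcont : @Continuous _ _ (weakStar (Ell2 X)) _ fun A : Op X =>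
      ∑' n, inner ℂ (Function.extend e (a x) 0 n) (A (Function.extend e (a y) 0 n)) :=
    continuous_iff_le_induced.2 (iInf_le_of_le _ (iInf_le_of_le _ (iInf_le_of_le
      (hext _ (ha x hx)) (iInf_le_of_le (hext _ (ha y hy)) le_rfl))))
  convert hcont using 1
  funext A
  have hsum : Summable fun p => inner ℂ (a x p) (A (a y p)) := by
    refine Summable.of_norm_bounded (((ha x hx).add (ha y hy)).mul_left ‖A‖) fun p => ?_
    have h1 := norm_inner_le_norm (𝕜 := ℂ) (a x p) (A (a y p))
    have h2 := A.le_opNorm (a y p)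
    have h3 : ‖a x p‖ * ‖A (a y p)‖ ≤ ‖a x p‖ * (‖A‖ * ‖a y p‖) := by gcongr
    nlinarith [mul_nonneg (norm_nonneg A) (sq_nonneg (‖a x p‖ - ‖a y p‖)),
      mul_nonneg (norm_nonneg A) (sq_nonneg (‖a x p‖)),
      mul_nonneg (norm_nonneg A) (sq_nonneg (‖a y p‖))]
  have h1 : ∑' n, inner ℂ (Function.extend e (a x) 0 n) (A (Function.extend e (a y) 0 n))
      = ∑' p, inner ℂ (a x p) (A (a y p)) := by
    rw [← he.tsum_eq]
    · simp [he.extend_apply]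
    · intro n hn
      by_contra hn'
      refine hn ?_
      simp only
      rw [Function.extend_apply' _ _ _ (by simpa using hn')]
      simp
  rw [h1, hsum.tsum_prod]
  refine tsum_congr fun n => ?_
  simp only [ampl, ContinuousLinearMap.comp_apply]
  rw [← ContinuousLinearMap.adjoint_inner_left, lp.inner_eq_tsum]
  rfl

theorem pair_injective (X Y : Type) : Function.Injective fun p : X × Y => (p.1, p.2) :=
  fun _ _ h => h

theorem swap_pair_injective (X Y : Type) : Function.Injective fun p : Y × X => (p.2, p.1) :=
  fun _ _ h => Prod.ext (Prod.mk.inj h).2 (Prod.mk.inj h).1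

/-- The operator `A ⊗ B` on `ℓ²(X) ⊗ ℓ²(Y) = ℓ²(X × Y)`, where `ξ_x ⊗ ξ_y = ξ_{(x, y)}`, as the
product of `A ⊗ 1` and `1 ⊗ B`. -/
def tensorOp {X Y : Type} (A : Op X) (B : Op Y) : Op (X × Y) :=
  ampl (fun (y : Y) (x : X) => (x, y)) (swap_pair_injective X Y) A ∘L
    ampl (fun (x : X) (y : Y) => (x, y)) (pair_injective X Y) B

theorem tensorOp_ket {X Y : Type} (A : Op X) (B : Op Y) (x x' : X) (y y' : Y) :
    tensorOp A B (ket (x, y)) (x', y') = A (ket x) x' * B (ket y) y' := by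
  have hX (y : Y) : Function.Injective fun x : X => (x, y) := fun _ _ h => (Prod.mk.inj h).1
  have hY (x : X) : Function.Injective fun y : Y => (x, y) := fun _ _ h => (Prod.mk.inj h).2
  let ev {Z : Type} (z : Z) : Ell2 Z →L[ℂ] ℂ := innerSL ℂ (ket z)
  have hev {Z : Type} (z : Z) (f : Ell2 Z) : ev z f = f z := inner_ket z f
  let T := ampl (fun (y : Y) (x : X) => (x, y)) (swap_pair_injective X Y) A
  have hT (y : Y) : T (ket (x, y)) = relabel (fun x : X => (x, y)) (hX y) (A (ket x)) :=
    ampl_ket (fun (y : Y) (x : X) => (x, y)) (swap_pair_injective X Y) A y (hX y) x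
  have key : ev (x', y') ∘L T ∘L (relabel (fun y : Y => (x, y)) (hY x)).toContinuousLinearMap
      = (A (ket x) x') • ev y' := by
    refine ket_ext fun z => ?_
    have h2 : ev (x', y') ∘L (relabel (fun x : X => (x, z)) (hX z)).toContinuousLinearMap
        = (ket z y') • ev x' := by
      refine ket_ext fun t => ?_
      have c1 : ev (x', y') (ket (t, z)) = ket (t, z) (x', y') := hev _ _
      have c2 : ev x' (ket t) = ket t x' := hev _ _
      simp only [ContinuousLinearMap.comp_apply, LinearIsometry.coe_toContinuousLinearMap,
        relabel_ket, c1, smul_apply, c2, smul_eq_mul]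
      simp only [← inner_ket]
      classical
      simp only [orthonormal_iff_ite.1 (orthonormal_ket _), Prod.mk.injEq]
      by_cases h : x' = t <;> by_cases h' : y' = z <;> simp [h, h']
    have h3 := congrArg (fun S : Ell2 X →L[ℂ] ℂ => S (A (ket x))) h2
    have c3 : ev x' (A (ket x)) = A (ket x) x' := hev _ _
    have c4 : ev y' (ket z) = ket z y' := hev _ _
    simp only [ContinuousLinearMap.comp_apply, LinearIsometry.coe_toContinuousLinearMap,
      smul_apply, c3, smul_eq_mul] at h3
    simp only [ContinuousLinearMap.comp_apply, LinearIsometry.coe_toContinuousLinearMap,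
      relabel_ket, hT, h3, smul_apply, c4, smul_eq_mul]
    exact mul_comm _ _
  have h1 : tensorOp A B (ket (x, y)) = T (relabel (fun y : Y => (x, y)) (hY x) (B (ket y))) :=
    congrArg T (ampl_ket (fun (x : X) (y : Y) => (x, y)) (pair_injective X Y) B x (hY x) y)
  have h4 := congrArg (fun S : Ell2 Y →L[ℂ] ℂ => S (B (ket y))) key
  rw [h1, ← hev, ← hev y']
  exact h4

/-! ### The free semigroup algebra -/

/-- The unital free semigroup on `d` generators. -/
abbrev Word (d : ℕ) : Type := FreeMonoid (Fin d)

/-- The operator `L_u` of the left regular representation, `L_u ξ_w = ξ_{uw}`. -/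
def leftOp {d : ℕ} (u : Word d) : Op (Word d) :=
  (relabel (fun w : Word d => u * w) (mul_right_injective u)).toContinuousLinearMap

theorem leftOp_ket {d : ℕ} (u w : Word d) : leftOp u (ket w) = ket (u * w) :=
  relabel_ket (fun w : Word d => u * w) (mul_right_injective u) w

/-- The free semigroup algebra `𝓛_d`: the smallest unital subalgebra of the bounded operators on
`ℓ²(Word d)` which is closed in the weak operator topology and contains all `L_u`. -/
def algL (d : ℕ) : Subalgebra ℂ (Op (Word d)) :=
  sInf {S | Set.range leftOp ⊆ (S : Set (Op (Word d))) ∧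
    IsClosed {T : Ell2 (Word d) →WOT[ℂ] Ell2 (Word d) | T.toCLM ∈ S}}

/-- Pairs of words without a common nonempty prefix. -/
def PrefixFree (d : ℕ) : Type :=
  {p : Word d × Word d // ∀ a u v : Word d, p.1 = a * u → p.2 = a * v → a = 1}

/-- `((u, v), w) ↦ (wu, wv)`. Every pair of words is obtained from exactly one word `w` and one
pair `(u, v)` without common nonempty prefix. -/
def prepend {d : ℕ} (p : PrefixFree d) (w : Word d) : Word d × Word d :=
  (w * p.1.1, w * p.1.2)

theorem prepend_injective (d : ℕ) :
    Function.Injective fun q : PrefixFree d × Word d => prepend q.1 q.2 := by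
  have key : ∀ (p p' : PrefixFree d) (w a : Word d),
      prepend p w = prepend p' (w * a) → (p, w) = (p', w * a) := by
    intro p p' w a h
    simp only [prepend, Prod.mk.injEq, mul_assoc, mul_right_inj] at h
    have ha : a = 1 := p.2 a _ _ h.1 h.2
    subst ha
    simp only [one_mul] at h
    rw [mul_one, Prod.mk.injEq]
    exact ⟨Subtype.ext (Prod.ext h.1 h.2), rfl⟩
  rintro ⟨p, w⟩ ⟨p', w'⟩ h
  have h' : prepend p w = prepend p' w' := h
  have h1 : w.toList ++ p.1.1.toList = w'.toList ++ p'.1.1.toList :=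
    congrArg (fun q : Word d × Word d => q.1.toList) h'
  rcases List.append_eq_append_iff.1 h1 with ⟨a, ha, _⟩ | ⟨a, ha, _⟩
  · have e : w' = w * FreeMonoid.ofList a := ha
    subst e
    exact key _ _ _ _ h'
  · have e : w = w' * FreeMonoid.ofList a := ha
    subst e
    exact (key _ _ _ _ h'.symm).symm

theorem prepend_surjective (d : ℕ) :
    Function.Surjective fun q : PrefixFree d × Word d => prepend q.1 q.2 := by
  rintro ⟨u, v⟩
  generalize hn : u.length = n
  induction n using Nat.strong_induction_on generalizing u v with
  | _ n ih =>
    by_cases h : ∀ a u' v' : Word d, u = a * u' → v = a * v' → a = 1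
    · exact ⟨(⟨(u, v), h⟩, 1), by simp [prepend]⟩
    · push Not at h
      obtain ⟨a, u', v', rfl, rfl, ha⟩ := h
      have hl : a.length ≠ 0 := fun h0 => ha (FreeMonoid.length_eq_zero.1 h0)
      rw [FreeMonoid.length_mul] at hn
      obtain ⟨⟨p, w⟩, hp⟩ := ih u'.length (by omega) u' v' rfl
      refine ⟨(p, a * w), ?_⟩
      simp only [prepend, Prod.mk.injEq] at hp ⊢
      exact ⟨by rw [mul_assoc, hp.1], by rw [mul_assoc, hp.2]⟩

/-- The comultiplication of `𝓛_d`, with `ℓ²(Word d) ⊗ ℓ²(Word d) = ℓ²(Word d × Word d)`: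
if `A` has the Fourier series `∑ a_w L_w`, then `Δ(A) ξ_{(u, v)} = ∑ a_w ξ_{(wu, wv)}`. On
the span of the orthonormal vectors `ξ_{(wu, wv)}`, `w ∈ Word d`, for fixed `u`, `v` without
common nonempty prefix, it is a copy of `A`. It is the weak*-continuous unital homomorphism with
`Δ(L_w) = L_w ⊗ L_w`: see `comul_leftOp`, `comul_one`, `comul_mul`, `comul_add`, `comul_smul` and
`continuous_comul`. -/
def comul {d : ℕ} (A : Op (Word d)) : Op (Word d × Word d) :=
  ampl prepend (prepend_injective d) A

theorem comul_leftOp {d : ℕ} (w : Word d) : comul (leftOp w) = tensorOp (leftOp w) (leftOp w) := by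
  refine ket_ext fun q => ?_
  have hp (p : PrefixFree d) : Function.Injective (prepend p) :=
    fun _ _ h => (Prod.mk.inj (prepend_injective d (a₁ := (p, _)) (a₂ := (p, _)) h)).2
  have hl (x : Word d) : Function.Injective fun y : Word d => (x, y) :=
    fun _ _ h => (Prod.mk.inj h).2
  have hr (y : Word d) : Function.Injective fun x : Word d => (x, y) :=
    fun _ _ h => (Prod.mk.inj h).1
  have e1 : tensorOp (leftOp w) (leftOp w) (ket q) = ket (w * q.1, w * q.2) := by
    obtain ⟨u, v⟩ := q
    have f1 := ampl_ket (fun (x : Word d) (y : Word d) => (x, y)) (pair_injective _ _)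
      (leftOp w) u (hl u) v
    have f2 := ampl_ket (fun (y : Word d) (x : Word d) => (x, y)) (swap_pair_injective _ _)
      (leftOp w) (w * v) (hr (w * v)) u
    rw [leftOp_ket, relabel_ket] at f1 f2
    rw [tensorOp, ContinuousLinearMap.comp_apply, f1, f2]
  rw [e1]
  obtain ⟨⟨p, v⟩, rfl⟩ := prepend_surjective d q
  simp only [comul, ampl_ket _ _ _ p (hp p), leftOp_ket, relabel_ket]
  simp only [prepend, mul_assoc]

theorem comul_one {d : ℕ} : comul (1 : Op (Word d)) = 1 := by
  refine ket_ext fun q => ?_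
  have hp (p : PrefixFree d) : Function.Injective (prepend p) :=
    fun _ _ h => (Prod.mk.inj (prepend_injective d (a₁ := (p, _)) (a₂ := (p, _)) h)).2
  obtain ⟨⟨p, v⟩, rfl⟩ := prepend_surjective d q
  simp only [comul, ampl_ket _ _ _ p (hp p), one_apply_eq_self, relabel_ket]

theorem comul_mul {d : ℕ} (A B : Op (Word d)) : comul (A * B) = comul A * comul B :=
  ampl_mul prepend (prepend_injective d) A B

theorem comul_add {d : ℕ} (A B : Op (Word d)) : comul (A + B) = comul A + comul B :=
  ampl_add prepend (prepend_injective d) A B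

theorem comul_smul {d : ℕ} (c : ℂ) (A : Op (Word d)) : comul (c • A) = c • comul A :=
  ampl_smul prepend (prepend_injective d) c A

theorem continuous_comul (d : ℕ) :
    @Continuous _ _ (weakStar (Ell2 (Word d))) (weakStar (Ell2 (Word d × Word d))) comul := by
  have : Countable (Word d) := inferInstanceAs (Countable (List (Fin d)))
  have : Countable (PrefixFree d) := inferInstanceAs (Countable (Subtype _))
  exact continuous_ampl prepend (prepend_injective d)
/-! ### Homogeneous coideals -/

/-- The homogeneous elements of degree `n` of `𝓛_d`: the span of the `L_w` with `|w| = n`. -/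
def homogeneousPart (d n : ℕ) : Submodule ℂ (Op (Word d)) :=
  Submodule.span ℂ {A | ∃ w : Word d, w.length = n ∧ A = leftOp w}

/-- `J` is homogeneous: it is the weak*-closed span of its homogeneous elements. -/
def IsHomogeneous {d : ℕ} (J : Set (Op (Word d))) : Prop :=
  J = weakStarSpan {A | A ∈ J ∧ ∃ n, A ∈ homogeneousPart d n}

/-- `J` is a coideal of `𝓛_d`: a weak*-closed subspace of `𝓛_d` such that `Δ(J)` is contained in
the weak*-closure of `J ⊗ 𝓛_d + 𝓛_d ⊗ J`. -/
structure IsCoideal {d : ℕ} (J : Set (Op (Word d))) : Prop where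
  isSubspace : ∃ V : Submodule ℂ (Op (Word d)), (V : Set (Op (Word d))) = J
  subset_algL : J ⊆ algL d
  isClosed : @IsClosed _ (weakStar (Ell2 (Word d))) J
  comul_mem : ∀ A ∈ J, comul A ∈ weakStarSpan
    ({T | ∃ B ∈ J, ∃ C ∈ algL d, T = tensorOp B C} ∪
      {T | ∃ B ∈ algL d, ∃ C ∈ J, T = tensorOp B C})

end NCToeplitz

end

open NCToeplitz

noncomputable section

namespace NCToeplitz

/-! ### The weak* topology as a vector space topology -/

section WeakStar

variable {H : Type*} [NormedAddCommGroup H] [InnerProductSpace ℂ H]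

/-! Fix a degree `n`. There are finitely many words of length `n`, and a function `f` on them gives
the weak*-continuous functional `pairing n f`, which weights the Fourier coefficients of degree `n`
by `f`. Since `L_w` is group-like, `(pairing n f ⊗ pairing n g) ∘ Δ = pairing n (f * g)`: the
comultiplication is dual to pointwise multiplication (`tensorPairing_comul`). Hence the annihilator
of a coideal in degree `n` is closed under products (`mul_mem_annihilator`).

A subalgebra of the functions on a finite set, possibly without unit, consists of all functions that
vanish on some subset and are constant on the classes of a partition of the rest;
`exists_indicator_mem_annihilator` produces the indicators of these classes. Dually, the degree `n`
part of `J` is spanned by the `L_w` with `w` in the zero set and the differences `L_u - L_v` within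
a class (`ofCoeffs_mem`, `homogeneous_mem_span_generators`). Homogeneity then recovers `J` from its
graded parts.

Conversely, such a span is a coideal because of the splitting in `comul_sub_leftOp` and the weak*
continuity of `Δ`. -/

theorem summable_inner_apply {x y : ℕ → H} (hx : Summable fun n => ‖x n‖ ^ 2)
    (hy : Summable fun n => ‖y n‖ ^ 2) (A : H →L[ℂ] H) :
    Summable fun n => inner ℂ (x n) (A (y n)) := by
  refine Summable.of_norm_bounded ((hx.add hy).mul_left ‖A‖) fun n => ?_
  have h1 := norm_inner_le_norm (𝕜 := ℂ) (x n) (A (y n))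
  have h3 : ‖x n‖ * ‖A (y n)‖ ≤ ‖x n‖ * (‖A‖ * ‖y n‖) := by
    gcongr
    exact A.le_opNorm _
  nlinarith [mul_nonneg (norm_nonneg A) (sq_nonneg (‖x n‖ - ‖y n‖)),
    mul_nonneg (norm_nonneg A) (sq_nonneg (‖x n‖)),
    mul_nonneg (norm_nonneg A) (sq_nonneg (‖y n‖))]

/-- The normal functional `A ↦ ∑ ⟨x_n, A y_n⟩`. -/
def normalFunctional {x y : ℕ → H} (hx : Summable fun n => ‖x n‖ ^ 2)
    (hy : Summable fun n => ‖y n‖ ^ 2) : (H →L[ℂ] H) →ₗ[ℂ] ℂ where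
  toFun A := ∑' n, inner ℂ (x n) (A (y n))
  map_add' A B := by
    rw [← (summable_inner_apply hx hy A).tsum_add (summable_inner_apply hx hy B)]
    simp only [add_apply, inner_add_right]
  map_smul' c A := by
    simp only [smul_apply, inner_smul_right, tsum_mul_left, RingHom.id_apply, smul_eq_mul]

/-- The weak* topology is an infimum of topologies induced by linear functionals, and compatibility
with the vector space operations passes to infima. -/
theorem isTopologicalAddGroup_weakStar :
    @IsTopologicalAddGroup (H →L[ℂ] H) (weakStar H) _ := by
  refine topologicalAddGroup_iInf fun x => topologicalAddGroup_iInf fun y =>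
    topologicalAddGroup_iInf fun hx => topologicalAddGroup_iInf fun hy => ?_
  exact topologicalAddGroup_induced (normalFunctional hx hy)

theorem continuousSMul_weakStar :
    @ContinuousSMul ℂ (H →L[ℂ] H) _ _ (weakStar H) := by
  refine continuousSMul_iInf fun x => continuousSMul_iInf fun y =>
    continuousSMul_iInf fun hx => continuousSMul_iInf fun hy => ?_
  exact continuousSMul_induced (normalFunctional hx hy)

theorem continuous_inner_apply (x y : H) :
    @Continuous (H →L[ℂ] H) ℂ (weakStar H) _ fun A => inner ℂ x (A y) := by
  -- A single matrix coefficient is the normal functional of two sequences supported at index `0`.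
  have hs (z : H) : Summable fun n => ‖(Pi.single 0 z : ℕ → H) n‖ ^ 2 :=
    summable_of_ne_finset_zero (s := {0}) fun n hn => by
      simp [Pi.single_eq_of_ne (M := fun _ => H) (Finset.notMem_singleton.1 hn)]
  have h : @Continuous (H →L[ℂ] H) ℂ (weakStar H) _ fun A =>
      ∑' n, inner ℂ ((Pi.single 0 x : ℕ → H) n) (A ((Pi.single 0 y : ℕ → H) n)) :=
    continuous_iff_le_induced.2 (iInf_le_of_le _ (iInf_le_of_le _ (iInf_le_of_le
      (hs x) (iInf_le_of_le (hs y) le_rfl))))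
  convert h using 1
  funext A
  rw [tsum_eq_single 0 fun n hn => by simp [Pi.single_eq_of_ne (M := fun _ => H) hn]]
  simp

/-- The weak*-closed linear span of a set of operators, as a subspace. -/
def weakStarSubmodule (S : Set (H →L[ℂ] H)) : Submodule ℂ (H →L[ℂ] H) :=
  let _ := weakStar H
  haveI : IsTopologicalAddGroup (H →L[ℂ] H) := isTopologicalAddGroup_weakStar
  haveI : ContinuousSMul ℂ (H →L[ℂ] H) := continuousSMul_weakStar
  (Submodule.span ℂ S).topologicalClosure

theorem isClosed_weakStarSpan (S : Set (H →L[ℂ] H)) :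
    @IsClosed _ (weakStar H) (weakStarSpan S) :=
  @isClosed_closure _ (weakStar H) _

theorem subset_weakStarSpan (S : Set (H →L[ℂ] H)) : S ⊆ weakStarSpan S :=
  Submodule.subset_span.trans (@subset_closure _ (weakStar H) _)

theorem weakStarSpan_subset {S : Set (H →L[ℂ] H)} (M : Submodule ℂ (H →L[ℂ] H))
    (hM : @IsClosed _ (weakStar H) (M : Set (H →L[ℂ] H))) (h : S ⊆ M) :
    weakStarSpan S ⊆ M :=
  @closure_minimal _ (weakStar H) _ _ (Submodule.span_le.2 h) hM

/-- A weak*-continuous linear map sends the weak*-closed span of `S` into any weak*-closed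
subspace which contains the image of `S`. -/
theorem map_mem_of_mem_weakStarSpan {S : Set (H →L[ℂ] H)} {E : Type*} [AddCommGroup E]
    [Module ℂ E] {t : TopologicalSpace E} (Φ : (H →L[ℂ] H) →ₗ[ℂ] E)
    (hΦ : @Continuous _ _ (weakStar H) t Φ) (M : Submodule ℂ E) (hM : IsClosed (M : Set E))
    (h : ∀ A ∈ S, Φ A ∈ M) {A : H →L[ℂ] H} (hA : A ∈ weakStarSpan S) : Φ A ∈ M :=
  weakStarSpan_subset (M.comap Φ) (@IsClosed.preimage _ _ (weakStar H) t Φ hΦ _ hM) h hA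

/-- A WOT-closed set of operators is weak*-closed. -/
theorem isClosed_weakStar_of_isClosed_wot [CompleteSpace H] {S : Set (H →L[ℂ] H)}
    (h : IsClosed {T : H →WOT[ℂ] H | T.toCLM ∈ S}) : @IsClosed _ (weakStar H) S := by
  let _ := weakStar H
  -- The identity is continuous from weak* to WOT: by Riesz, each WOT functional `f (A y)` is a
  -- matrix coefficient.
  have hc : Continuous (ContinuousLinearMapWOT.ofCLM : (H →L[ℂ] H) → H →WOT[ℂ] H) := by
    refine ContinuousLinearMapWOT.continuous_of_dual_apply_continuous fun y f => ?_
    convert continuous_inner_apply ((InnerProductSpace.toDual ℂ H).symm f) y using 2 with A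
    exact InnerProductSpace.toDual_symm_apply.symm
  exact h.preimage hc

end WeakStar

/-! ### Bilinearity of the tensor product, linearity of the comultiplication -/

theorem ampl_sub {I X Z : Type} (g : I → X → Z)
    (hg : Function.Injective fun p : I × X => g p.1 p.2) (A B : Op X) :
    ampl g hg (A - B) = ampl g hg A - ampl g hg B := by
  rw [eq_sub_iff_add_eq, ← ampl_add, sub_add_cancel]

theorem tensorOp_sub_left {X Y : Type} (A A' : Op X) (B : Op Y) :
    tensorOp (A - A') B = tensorOp A B - tensorOp A' B := by
  simp only [tensorOp, ampl_sub, ContinuousLinearMap.sub_comp]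

theorem tensorOp_sub_right {X Y : Type} (A : Op X) (B B' : Op Y) :
    tensorOp A (B - B') = tensorOp A B - tensorOp A B' := by
  simp only [tensorOp, ampl_sub, ContinuousLinearMap.comp_sub]

/-- The comultiplication as a linear map. -/
def comulLinear (d : ℕ) : Op (Word d) →ₗ[ℂ] Op (Word d × Word d) where
  toFun := comul
  map_add' := comul_add
  map_smul' := comul_smul

theorem comulLinear_apply {d : ℕ} (A : Op (Word d)) : comulLinear d A = comul A := rfl

/-- Insert the mixed term `L_u ⊗ L_v` and telescope. Each summand has the difference as one tensor
factor, which is the coideal condition. -/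
theorem comul_sub_leftOp {d : ℕ} (u v : Word d) :
    comul (leftOp u - leftOp v) =
      tensorOp (leftOp u) (leftOp u - leftOp v) + tensorOp (leftOp u - leftOp v) (leftOp v) := by
  rw [← comulLinear_apply, map_sub, comulLinear_apply, comulLinear_apply, comul_leftOp,
    comul_leftOp, tensorOp_sub_left, tensorOp_sub_right, sub_add_sub_cancel]

/-! ### Coideals spanned by words and differences of words -/

theorem leftOp_mem_algL {d : ℕ} (u : Word d) : leftOp u ∈ algL d :=
  Algebra.mem_sInf.2 fun _ hS => hS.1 ⟨u, rfl⟩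

theorem isClosed_algL (d : ℕ) :
    @IsClosed _ (weakStar (Ell2 (Word d))) (algL d : Set (Op (Word d))) := by
  let _ := weakStar (Ell2 (Word d))
  rw [algL, Algebra.coe_sInf]
  exact isClosed_biInter fun S hS => isClosed_weakStar_of_isClosed_wot hS.2

theorem leftOp_mem_homogeneousPart {d n : ℕ} {w : Word d} (hw : w.length = n) :
    leftOp w ∈ homogeneousPart d n :=
  Submodule.subset_span ⟨w, hw, rfl⟩

/-- The generators attached to a set `W` of words and a family `V` of sets of words. -/
def generators {d : ℕ} (W : Set (Word d)) (V : ℕ → Set (Word d)) : Set (Op (Word d)) :=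
  {A | ∃ i, ∃ u ∈ V i, ∃ v ∈ V i, A = leftOp u - leftOp v} ∪ {A | ∃ w ∈ W, A = leftOp w}

theorem isHomogeneous_weakStarSpan {d : ℕ} {S : Set (Op (Word d))}
    (hS : ∀ A ∈ S, ∃ n, A ∈ homogeneousPart d n) : IsHomogeneous (weakStarSpan S) := by
  refine Set.Subset.antisymm ?_ ?_
  · exact weakStarSpan_subset (weakStarSubmodule _) (isClosed_weakStarSpan _) fun A hA =>
      subset_weakStarSpan _ ⟨subset_weakStarSpan _ hA, hS A hA⟩
  · exact weakStarSpan_subset (weakStarSubmodule _) (isClosed_weakStarSpan _) fun A hA => hA.1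

theorem isHomogeneous_weakStarSpan_generators {d : ℕ} {W : Set (Word d)} {V : ℕ → Set (Word d)}
    (hV : ∀ i, ∃ n, ∀ w ∈ V i, w.length = n) : IsHomogeneous (weakStarSpan (generators W V)) := by
  refine isHomogeneous_weakStarSpan ?_
  rintro A (⟨i, u, hu, v, hv, rfl⟩ | ⟨w, _, rfl⟩)
  · obtain ⟨n, hn⟩ := hV i
    exact ⟨n, sub_mem (leftOp_mem_homogeneousPart (hn u hu)) (leftOp_mem_homogeneousPart (hn v hv))⟩
  · exact ⟨_, leftOp_mem_homogeneousPart rfl⟩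

/-- Both `algL` and the target of `Δ` are weak*-closed subspaces, so the inclusions need checking
only on generators. -/
theorem isCoideal_weakStarSpan_generators {d : ℕ} (W : Set (Word d)) (V : ℕ → Set (Word d)) :
    IsCoideal (weakStarSpan (generators W V)) where
  isSubspace := ⟨weakStarSubmodule _, rfl⟩
  subset_algL := by
    refine weakStarSpan_subset (algL d).toSubmodule (isClosed_algL d) ?_
    rintro A (⟨i, u, -, v, -, rfl⟩ | ⟨w, -, rfl⟩)
    · exact sub_mem (leftOp_mem_algL u) (leftOp_mem_algL v)
    · exact leftOp_mem_algL w
  isClosed := isClosed_weakStarSpan _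
  comul_mem A hA := by
    refine map_mem_of_mem_weakStarSpan (comulLinear d) (continuous_comul d) (weakStarSubmodule _)
      (isClosed_weakStarSpan _) ?_ hA
    intro B hB
    have hB' := subset_weakStarSpan _ hB
    rcases hB with ⟨i, u, hu, v, hv, rfl⟩ | ⟨w, hw, rfl⟩
    · rw [comulLinear_apply, comul_sub_leftOp]
      exact add_mem
        (subset_weakStarSpan _ (Or.inr ⟨_, leftOp_mem_algL u, _, hB', rfl⟩))
        (subset_weakStarSpan _ (Or.inl ⟨_, hB', _, leftOp_mem_algL v, rfl⟩))
    · rw [comulLinear_apply, comul_leftOp]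
      exact subset_weakStarSpan _ (Or.inl ⟨_, hB', _, leftOp_mem_algL w, rfl⟩)

/-! ### Pairing operators with functions on words of a fixed length -/

/-- The words of length `n`. -/
def wordsOfLength (d n : ℕ) : Finset (Word d) :=
  Set.Finite.toFinset (s := {w : Word d | w.length = n}) (List.finite_length_eq (Fin d) n)

theorem mem_wordsOfLength {d n : ℕ} {w : Word d} : w ∈ wordsOfLength d n ↔ w.length = n :=
  Set.Finite.mem_toFinset _

/-- The `w`-th Fourier coefficient `⟨ξ_w, A ξ_1⟩` of an operator. -/
def coeff {d : ℕ} (w : Word d) : Op (Word d) →ₗ[ℂ] ℂ where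
  toFun A := inner ℂ (ket w) (A (ket 1))
  map_add' A B := by rw [add_apply, inner_add_right]
  map_smul' c A := by rw [smul_apply, inner_smul_right, RingHom.id_apply, smul_eq_mul]

theorem coeff_apply {d : ℕ} (w : Word d) (A : Op (Word d)) :
    coeff w A = inner ℂ (ket w) (A (ket 1)) := rfl

theorem coeff_leftOp {d : ℕ} [DecidableEq (Word d)] (w u : Word d) :
    coeff w (leftOp u) = if w = u then 1 else 0 := by
  rw [coeff_apply, leftOp_ket, mul_one, orthonormal_iff_ite.1 (orthonormal_ket _)]

theorem continuous_coeff {d : ℕ} (w : Word d) :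
    @Continuous _ _ (weakStar (Ell2 (Word d))) _ (coeff w) :=
  continuous_inner_apply _ _

/-- The functional `A ↦ ∑_{|w| = n} f(w) a_w` on operators with Fourier coefficients `a_w`. -/
def pairing {d : ℕ} (n : ℕ) (f : Word d → ℂ) : Op (Word d) →ₗ[ℂ] ℂ :=
  ∑ w ∈ wordsOfLength d n, f w • coeff w

theorem pairing_apply {d : ℕ} (n : ℕ) (f : Word d → ℂ) (A : Op (Word d)) :
    pairing n f A = ∑ w ∈ wordsOfLength d n, f w * coeff w A := by
  simp [pairing]

theorem pairing_leftOp {d : ℕ} (n : ℕ) (f : Word d → ℂ) (u : Word d) :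
    pairing n f (leftOp u) = if u.length = n then f u else 0 := by
  classical
  simp [pairing_apply, coeff_leftOp, mem_wordsOfLength]

theorem continuous_pairing {d : ℕ} (n : ℕ) (f : Word d → ℂ) :
    @Continuous _ _ (weakStar (Ell2 (Word d))) _ (pairing n f) := by
  let _ := weakStar (Ell2 (Word d))
  have h : Continuous fun A : Op (Word d) => ∑ w ∈ wordsOfLength d n, f w * coeff w A :=
    continuous_finsetSum _ fun w _ => (continuous_coeff w).const_mul (f w)
  convert h using 1
  funext A
  exact pairing_apply n f A

/-- The functional on `𝓛_d ⊗ 𝓛_d` which is `pairing n f ⊗ pairing n g`. -/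
def tensorPairing {d : ℕ} (n : ℕ) (f g : Word d → ℂ) : Op (Word d × Word d) →ₗ[ℂ] ℂ where
  toFun T := ∑ u ∈ wordsOfLength d n, ∑ v ∈ wordsOfLength d n,
    f u * g v * inner ℂ (ket (u, v)) (T (ket (1, 1)))
  map_add' S T := by
    simp only [add_apply, inner_add_right, mul_add, Finset.sum_add_distrib]
  map_smul' c T := by
    simp only [smul_apply, inner_smul_right, Finset.mul_sum, RingHom.id_apply, smul_eq_mul]
    simp only [mul_left_comm]

theorem tensorPairing_apply {d : ℕ} (n : ℕ) (f g : Word d → ℂ) (T : Op (Word d × Word d)) :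
    tensorPairing n f g T = ∑ u ∈ wordsOfLength d n, ∑ v ∈ wordsOfLength d n,
      f u * g v * inner ℂ (ket (u, v)) (T (ket (1, 1))) := rfl

theorem continuous_tensorPairing {d : ℕ} (n : ℕ) (f g : Word d → ℂ) :
    @Continuous _ _ (weakStar (Ell2 (Word d × Word d))) _ (tensorPairing n f g) := by
  let _ := weakStar (Ell2 (Word d × Word d))
  exact continuous_finsetSum _ fun u _ => continuous_finsetSum _ fun v _ =>
    (continuous_inner_apply _ _).const_mul _

theorem tensorPairing_tensorOp {d : ℕ} (n : ℕ) (f g : Word d → ℂ) (A B : Op (Word d)) :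
    tensorPairing n f g (tensorOp A B) = pairing n f A * pairing n g B := by
  simp only [tensorPairing_apply, pairing_apply, Finset.sum_mul_sum, coeff_apply, inner_ket,
    tensorOp_ket]
  exact Finset.sum_congr rfl fun u _ => Finset.sum_congr rfl fun v _ => by ring

theorem inner_ket_comul {d : ℕ} [DecidableEq (Word d)] (A : Op (Word d)) (u v : Word d) :
    inner ℂ (ket (u, v)) (comul A (ket (1, 1))) = if u = v then coeff u A else 0 := by
  -- The block of the pair `(1, 1)` has basis `ξ_(w, w)`, and `Δ(A)` acts on it as a copy of `A`; so
  -- `Δ(A) ξ_(1, 1)` is supported on the diagonal.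
  let p : PrefixFree d := ⟨(1, 1), fun a x _ h _ => by
    have h' := congrArg FreeMonoid.length h
    rw [FreeMonoid.length_mul, FreeMonoid.length_one] at h'
    exact FreeMonoid.length_eq_zero.1 (by omega)⟩
  have hp : Function.Injective (prepend p) :=
    fun _ _ h => (Prod.mk.inj (prepend_injective d (a₁ := (p, _)) (a₂ := (p, _)) h)).2
  have hpw (w : Word d) : prepend p w = (w, w) := by simp [prepend, p]
  have h1 : comul A (ket (1, 1)) = relabel (prepend p) hp (A (ket 1)) := by
    rw [← hpw, comul, ampl_ket _ _ _ p hp]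
  have h2 : innerSL ℂ (ket (u, v)) ∘L (relabel (prepend p) hp).toContinuousLinearMap
      = if u = v then innerSL ℂ (ket u) else 0 := by
    refine ket_ext fun w => ?_
    rw [ContinuousLinearMap.comp_apply, LinearIsometry.coe_toContinuousLinearMap, relabel_ket,
      hpw, innerSL_apply_apply, orthonormal_iff_ite.1 (orthonormal_ket _)]
    by_cases h : u = v
    · subst h
      simp [orthonormal_iff_ite.1 (orthonormal_ket _)]
    · have : (u, v) ≠ (w, w) := fun e => h ((Prod.mk.inj e).1.trans (Prod.mk.inj e).2.symm)
      simp [h, this]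
  have h3 := congrArg (fun S => S (A (ket 1))) h2
  simp only [ContinuousLinearMap.comp_apply, LinearIsometry.coe_toContinuousLinearMap,
    innerSL_apply_apply] at h3
  rw [h1, h3]
  split_ifs <;> rfl

/-- Only the diagonal coefficients of `Δ(A)` survive in the double sum, each with weight `f u * g
u`. -/
theorem tensorPairing_comul {d : ℕ} (n : ℕ) (f g : Word d → ℂ) (A : Op (Word d)) :
    tensorPairing n f g (comul A) = pairing n (f * g) A := by
  classical
  rw [tensorPairing_apply, pairing_apply]
  refine Finset.sum_congr rfl fun u hu => ?_
  simp [inner_ket_comul, hu]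

/-! ### The functions on words which annihilate a coideal -/

/-- The functions on words whose pairing in degree `n` vanishes on `J`. -/
def annihilator {d : ℕ} (J : Set (Op (Word d))) (n : ℕ) : Submodule ℂ (Word d → ℂ) where
  carrier := {f | ∀ A ∈ J, pairing n f A = 0}
  add_mem' hf hg A hA := by
    have h1 := hf A hA
    have h2 := hg A hA
    rw [pairing_apply] at h1 h2 ⊢
    simp only [Pi.add_apply, add_mul, Finset.sum_add_distrib, h1, h2, add_zero]
  zero_mem' A _ := by simp [pairing_apply]
  smul_mem' c f hf A hA := by
    have h1 := hf A hA
    rw [pairing_apply] at h1 ⊢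
    simp only [Pi.smul_apply, smul_eq_mul, mul_assoc, ← Finset.mul_sum, h1, mul_zero]

/-- The functional `pairing n f ⊗ pairing n g` kills `J ⊗ 𝓛_d` through `f` and `𝓛_d ⊗ J` through
`g`, hence by continuity the weak* closure of their sum, which contains `Δ(J)`. -/
theorem mul_mem_annihilator {d : ℕ} {J : Set (Op (Word d))} (hJ : IsCoideal J) {n : ℕ}
    {f g : Word d → ℂ} (hf : f ∈ annihilator J n) (hg : g ∈ annihilator J n) :
    f * g ∈ annihilator J n := by
  intro A hA
  rw [← tensorPairing_comul, ← Submodule.mem_bot ℂ]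
  refine map_mem_of_mem_weakStarSpan (tensorPairing n f g) (continuous_tensorPairing n f g) ⊥
    (by simp) ?_ (hJ.comul_mem A hA)
  rintro T (⟨B, hB, C, -, rfl⟩ | ⟨B, -, C, hC, rfl⟩)
  · rw [tensorPairing_tensorOp, hf B hB, zero_mul, Submodule.mem_bot]
  · rw [tensorPairing_tensorOp, hg C hC, mul_zero, Submodule.mem_bot]

/-- The operator `∑ a_w L_w` with finitely many Fourier coefficients. -/
def ofCoeffs (d : ℕ) : (Word d →₀ ℂ) →ₗ[ℂ] Op (Word d) :=
  Finsupp.linearCombination ℂ leftOp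

theorem ofCoeffs_single {d : ℕ} (w : Word d) : ofCoeffs d (Finsupp.single w 1) = leftOp w := by
  simp [ofCoeffs]

/-- A homogeneous element is the linear combination given by its Fourier coefficients. -/
theorem eq_sum_coeff {d n : ℕ} {A : Op (Word d)} (hA : A ∈ homogeneousPart d n) :
    A = ∑ w ∈ wordsOfLength d n, coeff w A • leftOp w := by
  classical
  induction hA using Submodule.span_induction with
  | mem A h =>
    obtain ⟨u, hu, rfl⟩ := h
    simp [coeff_leftOp, mem_wordsOfLength, hu]
  | zero => simp
  | add A B _ _ hA hB =>
    simp only [map_add, add_smul, Finset.sum_add_distrib]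
    rw [← hA, ← hB]
  | smul c A _ hA =>
    simp only [map_smul, smul_assoc, ← Finset.smul_sum]
    rw [← hA]

theorem pairing_of_mem_homogeneousPart {d m n : ℕ} (f : Word d → ℂ) {A : Op (Word d)}
    (hA : A ∈ homogeneousPart d m) (hmn : m ≠ n) : pairing n f A = 0 := by
  rw [eq_sum_coeff hA, map_sum]
  refine Finset.sum_eq_zero fun w hw => ?_
  rw [mem_wordsOfLength] at hw
  rw [map_smul, pairing_leftOp, if_neg (hw ▸ hmn), smul_zero]

/-- The annihilator of a homogeneous subspace in degree `n` determines which combinations of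
words of length `n` belong to it. -/
theorem ofCoeffs_mem {d : ℕ} {J : Submodule ℂ (Op (Word d))}
    (hJ : IsHomogeneous (J : Set (Op (Word d)))) {n : ℕ} {a : Word d →₀ ℂ}
    (ha : ∀ w ∈ a.support, w.length = n)
    (h : ∀ f ∈ annihilator (J : Set (Op (Word d))) n, pairing n f (ofCoeffs d a) = 0) :
    ofCoeffs d a ∈ J := by
  classical
  by_contra hn
  -- Separation is purely algebraic here: `φ` lives on finitely supported coefficient vectors, and
  -- its values on basis vectors define `f`.
  obtain ⟨φ, hφa, hφ⟩ := Submodule.exists_le_ker_of_notMem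
    (p := J.comap (ofCoeffs d)) (v := a) hn
  let f : Word d → ℂ := fun w => φ (Finsupp.single w 1)
  have hpair (b : Word d →₀ ℂ) (hb : ∀ w ∈ b.support, w.length = n) :
      pairing n f (ofCoeffs d b) = φ b := by
    conv_rhs => rw [← Finsupp.sum_single b, Finsupp.sum, map_sum]
    rw [ofCoeffs, Finsupp.linearCombination_apply, Finsupp.sum, map_sum]
    refine Finset.sum_congr rfl fun w hw => ?_
    rw [map_smul, pairing_leftOp, if_pos (hb w hw), ← map_smul, Finsupp.smul_single_one]
  refine hφa ((hpair a ha).symm.trans (h f fun A hA => ?_))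
  -- By homogeneity, `f` need only be tested on homogeneous elements of `J`: in degree `n` the
  -- pairing is `φ`, which vanishes on `J`; in other degrees it is zero.
  rw [hJ] at hA
  rw [← Submodule.mem_bot ℂ]
  refine map_mem_of_mem_weakStarSpan (pairing n f) (continuous_pairing n f) ⊥ (by simp) ?_ hA
  rintro B ⟨hBJ, m, hB⟩
  rw [Submodule.mem_bot]
  by_cases hmn : m = n
  · subst hmn
    let b : Word d →₀ ℂ := ∑ w ∈ wordsOfLength d m, Finsupp.single w (coeff w B)
    have hb : ofCoeffs d b = B := by
      conv_rhs => rw [eq_sum_coeff hB]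
      simp [b, ofCoeffs]
    have hs : ∀ w ∈ b.support, w.length = m := by
      intro w hw
      obtain ⟨v, hv, hwv⟩ := Finset.mem_biUnion.1 (Finsupp.support_finsetSum hw)
      rw [Finset.mem_singleton.1 (Finsupp.support_single_subset hwv)]
      exact mem_wordsOfLength.1 hv
    rw [← hb, hpair b hs]
    exact hφ (show ofCoeffs d b ∈ J from hb ▸ hBJ)
  · exact pairing_of_mem_homogeneousPart f hB hmn

/-! ### The words and classes of words of a homogeneous coideal -/

/-- Two words are equivalent if they have the same length and are not separated by the
annihilator of `J`. -/
def wordSetoid {d : ℕ} (J : Set (Op (Word d))) : Setoid (Word d) where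
  r u v := u.length = v.length ∧ ∀ f ∈ annihilator J u.length, f u = f v
  iseqv :=
    { refl := fun _ => ⟨rfl, fun _ _ => rfl⟩
      symm := fun h => ⟨h.1.symm, fun f hf => (h.2 f (h.1 ▸ hf)).symm⟩
      trans := fun h h' =>
        ⟨h.1.trans h'.1, fun f hf => (h.2 f hf).trans (h'.2 f (h.1 ▸ hf))⟩ }

theorem leftOp_sub_mem {d : ℕ} {J : Submodule ℂ (Op (Word d))}
    (hJ : IsHomogeneous (J : Set (Op (Word d)))) {u v : Word d}
    (h : wordSetoid (J : Set (Op (Word d))) u v) : leftOp u - leftOp v ∈ J := by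
  classical
  have e : ofCoeffs d (Finsupp.single u 1 - Finsupp.single v 1) = leftOp u - leftOp v := by
    rw [map_sub, ofCoeffs_single, ofCoeffs_single]
  rw [← e]
  refine ofCoeffs_mem hJ (n := u.length) (fun w hw => ?_) fun f hf => ?_
  · rcases Finset.mem_union.1 (Finsupp.support_sub hw) with hw | hw
    · rw [Finset.mem_singleton.1 (Finsupp.support_single_subset hw)]
    · rw [Finset.mem_singleton.1 (Finsupp.support_single_subset hw), h.1]
  · rw [e, map_sub, pairing_leftOp, pairing_leftOp, if_pos rfl, if_pos h.1.symm, h.2 f hf, sub_self]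

theorem leftOp_mem {d : ℕ} {J : Submodule ℂ (Op (Word d))}
    (hJ : IsHomogeneous (J : Set (Op (Word d)))) {w : Word d}
    (h : ∀ f ∈ annihilator (J : Set (Op (Word d))) w.length, f w = 0) : leftOp w ∈ J := by
  rw [← ofCoeffs_single]
  refine ofCoeffs_mem hJ (n := w.length) (fun v hv => ?_) fun f hf => ?_
  · rw [Finset.mem_singleton.1 (Finsupp.support_single_subset hv)]
  · rw [ofCoeffs_single, pairing_leftOp, if_pos rfl, h f hf]

/-- The annihilator of a coideal contains, up to words of other lengths, the indicator functions
of the classes of words on which it does not vanish. -/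
theorem exists_indicator_mem_annihilator {d : ℕ} {J : Set (Op (Word d))} (hJ : IsCoideal J)
    {u : Word d} {h : Word d → ℂ} (hh : h ∈ annihilator J u.length) (hu : h u ≠ 0) :
    ∃ f ∈ annihilator J u.length, (∀ v, wordSetoid J u v → f v = 1) ∧
      ∀ v, v.length = u.length → ¬ wordSetoid J u v → f v = 0 := by
  classical
  have key (s : Finset (Word d))
      (hs : ∀ v ∈ s, v.length = u.length ∧ ¬ wordSetoid J u v) :
      ∃ f ∈ annihilator J u.length, f u ≠ 0 ∧ ∀ v ∈ s, f v = 0 := by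
    induction s using Finset.induction_on with
    | empty => exact ⟨h, hh, hu, by simp⟩
    | insert x s _ ih =>
      obtain ⟨f, hf, hfu, hfs⟩ := ih fun v hv => hs v (Finset.mem_insert_of_mem hv)
      obtain ⟨hl, hx⟩ := hs x (Finset.mem_insert_self _ _)
      obtain ⟨g, hg, hgx⟩ : ∃ g ∈ annihilator J u.length, g u ≠ g x := by
        by_contra! hc
        exact hx ⟨hl.symm, hc⟩
      -- This is `f * (g - g x)`, expanded because constants need not lie in the annihilator. It
      -- vanishes at `x` and wherever `f` does, but not at `u`.
      refine ⟨f * g - g x • f, sub_mem (mul_mem_annihilator hJ hf hg)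
        (Submodule.smul_mem _ _ hf), ?_, fun v hv => ?_⟩
      · have : (f * g - g x • f) u = f u * (g u - g x) := by
          simp only [Pi.sub_apply, Pi.mul_apply, Pi.smul_apply, smul_eq_mul]
          ring
        rw [this]
        exact mul_ne_zero hfu (sub_ne_zero.2 hgx)
      · rcases Finset.mem_insert.1 hv with rfl | hv
        · simp [mul_comm]
        · simp [hfs v hv]
  obtain ⟨f, hf, hfu, hf0⟩ := key ((wordsOfLength d u.length).filter fun v => ¬ wordSetoid J u v)
    fun v hv => ⟨mem_wordsOfLength.1 (Finset.mem_filter.1 hv).1, (Finset.mem_filter.1 hv).2⟩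
  refine ⟨(f u)⁻¹ • f, Submodule.smul_mem _ _ hf, fun v hv => ?_, fun v hl hv => ?_⟩
  · rw [Pi.smul_apply, smul_eq_mul, ← hv.2 f hf, inv_mul_cancel₀ hfu]
  · rw [Pi.smul_apply, hf0 v (Finset.mem_filter.2 ⟨mem_wordsOfLength.2 hl, hv⟩), smul_zero]

/-- The words of `J`: those at which the annihilator of `J` vanishes. -/
def zeroWords {d : ℕ} (J : Set (Op (Word d))) : Set (Word d) :=
  {w | ∀ f ∈ annihilator J w.length, f w = 0}

theorem mem_zeroWords_of_wordSetoid {d : ℕ} {J : Set (Op (Word d))} {u v : Word d}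
    (h : wordSetoid J u v) (hu : u ∈ zeroWords J) : v ∈ zeroWords J :=
  fun f hf => ((h.2 f (h.1 ▸ hf)).symm).trans (hu f (h.1 ▸ hf))

/-- The classes of words outside `zeroWords J`, numbered by a map `e`. -/
def wordClass {d : ℕ} (J : Set (Op (Word d))) (e : Quotient (wordSetoid J) → ℕ) (i : ℕ) :
    Set (Word d) :=
  {w | w ∉ zeroWords J ∧ e (Quotient.mk _ w) = i}

/-- Group the Fourier coefficients of `A` by classes. Pairing with the indicator of a class outside
the zero set shows that its coefficients sum to zero, so `L_u` for a fixed representative `u` can be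
subtracted from every term. The sum is finite, so no closure is needed. -/
theorem homogeneous_mem_span_generators {d : ℕ} {J : Set (Op (Word d))} (hJ : IsCoideal J)
    (e : Quotient (wordSetoid J) → ℕ) {n : ℕ} {A : Op (Word d)} (hA : A ∈ J)
    (hAn : A ∈ homogeneousPart d n) :
    A ∈ Submodule.span ℂ (generators (zeroWords J) (wordClass J e)) := by
  classical
  rw [eq_sum_coeff hAn, ← Finset.sum_fiberwise_of_maps_to
    (t := (wordsOfLength d n).image (Quotient.mk (wordSetoid J)))
    (g := Quotient.mk (wordSetoid J)) (fun w hw => Finset.mem_image_of_mem _ hw)]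
  refine Submodule.sum_mem _ fun y hy => ?_
  obtain ⟨u, hu, rfl⟩ := Finset.mem_image.1 hy
  have hun : u.length = n := mem_wordsOfLength.1 hu
  have hrel {w : Word d} (h : Quotient.mk (wordSetoid J) w = Quotient.mk _ u) :
      wordSetoid J u w := (wordSetoid J).symm (Quotient.exact h)
  by_cases huW : u ∈ zeroWords J
  · refine Submodule.sum_mem _ fun w hw => Submodule.smul_mem _ _ (Submodule.subset_span ?_)
    exact Or.inr ⟨w, mem_zeroWords_of_wordSetoid (hrel (Finset.mem_filter.1 hw).2) huW, rfl⟩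
  · obtain ⟨h, hh, hhu⟩ : ∃ h ∈ annihilator J u.length, h u ≠ 0 := by
      simpa [zeroWords] using huW
    obtain ⟨f, hf, hf1, hf0⟩ := exists_indicator_mem_annihilator hJ hh hhu
    have hsum : ∑ w ∈ wordsOfLength d n with Quotient.mk (wordSetoid J) w = Quotient.mk _ u,
        coeff w A = 0 := by
      rw [← hf A hA, pairing_apply, hun, Finset.sum_filter]
      refine Finset.sum_congr rfl fun w hw => ?_
      by_cases hwu : Quotient.mk (wordSetoid J) w = Quotient.mk _ u
      · rw [if_pos hwu, hf1 w (hrel hwu), one_mul]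
      · rw [if_neg hwu, hf0 w (by rw [mem_wordsOfLength.1 hw, hun])
          (fun h => hwu (Quotient.sound ((wordSetoid J).symm h))), zero_mul]
    have hsplit : ∑ w ∈ wordsOfLength d n with Quotient.mk (wordSetoid J) w = Quotient.mk _ u,
        coeff w A • leftOp w =
        ∑ w ∈ wordsOfLength d n with Quotient.mk (wordSetoid J) w = Quotient.mk _ u,
          coeff w A • (leftOp w - leftOp u) := by
      simp only [smul_sub, Finset.sum_sub_distrib, ← Finset.sum_smul, hsum, zero_smul, sub_zero]
    rw [hsplit]
    refine Submodule.sum_mem _ fun w hw => Submodule.smul_mem _ _ (Submodule.subset_span ?_)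
    have hwu := (Finset.mem_filter.1 hw).2
    refine Or.inl ⟨e (Quotient.mk _ u), w, ⟨fun hw0 => huW ?_, by rw [hwu]⟩, u, ⟨huW, rfl⟩, rfl⟩
    exact mem_zeroWords_of_wordSetoid ((wordSetoid J).symm (hrel hwu)) hw0

theorem eq_weakStarSpan_generators {d : ℕ} {J : Set (Op (Word d))} (hh : IsHomogeneous J)
    (hJ : IsCoideal J) {e : Quotient (wordSetoid J) → ℕ} (he : Function.Injective e) :
    J = weakStarSpan (generators (zeroWords J) (wordClass J e)) := by
  refine Set.Subset.antisymm ?_ ?_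
  · conv_lhs => rw [hh]
    refine weakStarSpan_subset (weakStarSubmodule _) (isClosed_weakStarSpan _) ?_
    rintro A ⟨hA, n, hAn⟩
    exact @subset_closure _ (weakStar (Ell2 (Word d))) _ _
      (homogeneous_mem_span_generators hJ e hA hAn)
  · obtain ⟨M, rfl⟩ := hJ.isSubspace
    refine weakStarSpan_subset M hJ.isClosed ?_
    rintro A (⟨i, u, hu, v, hv, rfl⟩ | ⟨w, hw, rfl⟩)
    -- Injectivity of `e` is what makes two words with the same index equivalent.
    · exact leftOp_sub_mem hh (Quotient.exact (he (hu.2.trans hv.2.symm)))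
    · exact leftOp_mem hh hw

end NCToeplitz

end

open NCToeplitz
theorem proposition3p2 (d : ℕ) (J : Set (Op (Word d))) :
    (IsHomogeneous J ∧ IsCoideal J) ↔
      ∃ (W : Set (Word d)) (V : ℕ → Set (Word d)),
        (∀ i, Disjoint W (V i)) ∧
        (∀ i j, i ≠ j → Disjoint (V i) (V j)) ∧
        (∀ i, ∃ n, ∀ w ∈ V i, w.length = n) ∧
        J = weakStarSpan
          ({A | ∃ i, ∃ u ∈ V i, ∃ v ∈ V i, A = leftOp u - leftOp v} ∪
            {A | ∃ w ∈ W, A = leftOp w}) := by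
  constructor
  · rintro ⟨hh, hJ⟩
    have : Countable (Word d) := inferInstanceAs (Countable (List (Fin d)))
    -- There are countably many words, so the classes can be numbered. Indices outside the range of
    -- `e`, and those of classes inside `zeroWords J`, give empty sets.
    obtain ⟨e, he⟩ := exists_injective_nat (Quotient (wordSetoid J))
    refine ⟨zeroWords J, wordClass J e, fun i => ?_, fun i j hij => ?_, fun i => ?_,
      eq_weakStarSpan_generators hh hJ he⟩
    · exact Set.disjoint_left.2 fun w hw hw' => hw'.1 hw
    · exact Set.disjoint_left.2 fun w hw hw' => hij (hw.2.symm.trans hw'.2)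
    · by_cases hne : (wordClass J e i).Nonempty
      · obtain ⟨u, hu⟩ := hne
        exact ⟨u.length, fun w hw => (Quotient.exact (he (hw.2.trans hu.2.symm))).1⟩
      · exact ⟨0, fun w hw => (hne ⟨w, hw⟩).elim⟩
  · rintro ⟨W, V, -, -, hV, rfl⟩
    exact ⟨isHomogeneous_weakStarSpan_generators hV, isCoideal_weakStarSpan_generators W V⟩
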